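/- Let $A$ be a commutative Noetherian ring. Complexes are cochain complexes of $A$-modules indexed by $\mathbb{Z}$. Let $\mathsf{D}^{\mathsf b}(A)$ be the full subcategory of the derived category of $A$-modules consisting of the complexes with bounded finitely generated cohomology (every $H^n$ is finitely generated, and $H^n=0$ for all but finitely many $n$), and let $\mathsf{D}_{\mathsf{sg}}(A)=\mathsf{D}^{\mathsf b}(A)/\operatorname{Perf}(A)$ be the Verdier quotient by the perfect complexes, i.e. those isomorphic in $\mathsf{D}^{\mathsf b}(A)$ to a bounded complex of finitely generated projective modules. For complexes $M,N$ with bounded finitely generated cohomology and $q\in\mathbb{Z}$ put $$\operatorname{Ext}^q_A(M,N)=\operatorname{Hom}_{\mathsf{D}^{\mathsf b}(A)}(M,N[q]),\qquad \widehat{\operatorname{Ext}}{}^q_A(M,N)=\operatorname{Hom}_{\mathsf{D}_{\mathsf{sg}}(A)}(M,N[q]).$$ Let $M$ be a complex with bounded finitely generated cohomology, and let $T\xrightarrow{\gamma}P\xrightarrow{\delta}M$ be a complete resolution of $M$: $\gamma$ and $\delta$ are morphisms of complexes, $T$ is an acyclic complex of projective $A$-modules such that $\operatorname{Hom}_A(T,A)$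 is also acyclic, $P$ is a complex of projective $A$-modules with $P^i=0$ for $i\gg0$, $\delta$ is a quasi-isomorphism, and $\gamma^i$ is an isomorphism for $i\ll0$. Then for every $q\in\mathbb{Z}$ and every complex $N$ with bounded finitely generated cohomology and with $N^i=0$ for $i\gg0$ there is an isomorphism of $A$-modules $$\eta^q\colon H^q\operatorname{Hom}_A(T,N)\xrightarrow{\ \cong\ }\widehat{\operatorname{Ext}}{}^q_A(M,N),$$ natural in $N$, such that the square $$\begin{array}{ccc}H^q\operatorname{Hom}_A(P,N)&\xrightarrow{\,H^q\operatorname{Hom}_A(\gamma,N)\,}&H^q\operatorname{Hom}_A(T,N)\\ {\scriptstyle\cong}\big\downarrow&&{\scriptstyle\cong}\big\downarrow{\scriptstyle\eta^q}\\ \operatorname{Ext}^q_A(M,N)&\longrightarrow&\widehat{\operatorname{Ext}}{}^q_A(M,N)\end{array}$$ commutes. Here the lower map is induced by the quotient functor $\mathsf{D}^{\mathsf b}(A)\to\mathsf{D}_{\mathsf{sg}}(A)$, and the left vertical map, which is an isomorphism, sends the class of a morphism of complexes $z\colon P\to N[q]$ to $z\circ\delta^{-1}$. -/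

import Mathlib

universe w u

namespace StableExtension

noncomputable section

open CategoryTheory CategoryTheory.Limits CategoryTheory.Pretriangulated CochainComplex
open scoped ZeroObject

/-! ### Complexes with bounded finitely generated cohomology -/

/-- A complex of `A`-modules has bounded finitely generated cohomology. -/
def HasBoundedFGCohomology {A : Type u} [CommRing A]
    (K : CochainComplex (ModuleCat.{u} A) ℤ) : Prop :=
  (∀ n : ℤ, Module.Finite A (K.homology n)) ∧
    ∃ a b : ℤ, ∀ n : ℤ, (n < a ∨ b < n) → IsZero (K.homology n)

lemma HasBoundedFGCohomology.shift {A : Type u} [CommRing A]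
    {K : CochainComplex (ModuleCat.{u} A) ℤ}
    (hK : HasBoundedFGCohomology K) (q : ℤ) : HasBoundedFGCohomology (K⟦q⟧) := by
  have e (n : ℤ) : (K⟦q⟧).homology n ≅ K.homology (q + n) :=
    ((HomologicalComplex.homologyFunctor (ModuleCat.{u} A) (.up ℤ) 0).shiftIso
      q n (q + n) rfl).app K
  obtain ⟨h₁, a, b, h₂⟩ := hK
  refine ⟨fun n => ?_, a - q, b - q, fun n hn => (h₂ (q + n) (by lia)).of_iso (e n)⟩
  have := h₁ (q + n)
  exact Module.Finite.equiv (e n).symm.toLinearEquiv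

/-! ### The cohomology of the complex `Hom_A(K, L)`

A cochain of degree `q` is a family of maps `K.X i ⟶ L.X (i + q)`, and `Cocycle K L q` consists
of the cochains killed by the differential `δ` of `Hom_A(K, L)`. -/

section HomComplex

variable {A : Type u} [CommRing A]

/-- The submodule of coboundaries in the `A`-module of `q`-cocycles of `Hom_A(K, L)`. -/
def homCoboundaries (K L : CochainComplex (ModuleCat.{u} A) ℤ) (q : ℤ) :
    Submodule A (HomComplex.Cocycle K L q) where
  carrier := {z | ∃ β : HomComplex.Cochain K L (q - 1), HomComplex.δ (q - 1) q β = z}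
  zero_mem' := ⟨0, by simp⟩
  add_mem' := by
    rintro _ _ ⟨β, hβ⟩ ⟨β', hβ'⟩
    exact ⟨β + β', by simp [hβ, hβ']⟩
  smul_mem' := by
    rintro r _ ⟨β, hβ⟩
    exact ⟨r • β, by simp [hβ]⟩

/-- The `A`-module `H^q Hom_A(K, L)`. -/
abbrev HomCohomology (K L : CochainComplex (ModuleCat.{u} A) ℤ) (q : ℤ) : Type u :=
  HomComplex.Cocycle K L q ⧸ homCoboundaries K L q

/-- `H^q Hom_A(K, g)`, the map induced by `g : L ⟶ L'`. -/
def homCohomologyPostcomp (K : CochainComplex (ModuleCat.{u} A) ℤ)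
    {L L' : CochainComplex (ModuleCat.{u} A) ℤ} (g : L ⟶ L') (q : ℤ) :
    HomCohomology K L q →ₗ[A] HomCohomology K L' q :=
  Submodule.mapQ _ _
    { toFun := fun z => z.postcomp g
      map_add' := fun z z' => by ext; simp
      map_smul' := fun r z => by ext; simp }
    (by
      rintro z ⟨β, hβ⟩
      exact ⟨β.comp (HomComplex.Cochain.ofHom g) (add_zero _), by simp [hβ]⟩)

/-- `H^q Hom_A(f, L)`, the map induced by `f : K' ⟶ K`. -/
def homCohomologyPrecomp {K' K : CochainComplex (ModuleCat.{u} A) ℤ} (f : K' ⟶ K)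
    (L : CochainComplex (ModuleCat.{u} A) ℤ) (q : ℤ) :
    HomCohomology K L q →ₗ[A] HomCohomology K' L q :=
  Submodule.mapQ _ _
    { toFun := fun z => z.precomp f
      map_add' := fun z z' => by ext; simp
      map_smul' := fun r z => by ext; simp }
    (by
      rintro z ⟨β, hβ⟩
      exact ⟨(HomComplex.Cochain.ofHom f).comp β (zero_add _), by simp [hβ]⟩)

end HomComplex

/-! ### Complete resolutions -/

/-- A complete resolution `T ⟶ P ⟶ M`. The projective modules need not be finitely generated. -/
structure IsCompleteResolution {A : Type u} [CommRing A]
    {T P M : CochainComplex (ModuleCat.{u} A) ℤ} (γ : T ⟶ P) (δ : P ⟶ M) : Prop where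
  projective_T : ∀ i : ℤ, Module.Projective A (T.X i)
  acyclic_T : T.Acyclic
  /-- `Hom_A(T, A)` is acyclic, with `A` viewed as a complex concentrated in degree `0`. -/
  acyclic_dual : ∀ q : ℤ,
    Subsingleton (HomCohomology T ((singleFunctor (ModuleCat.{u} A) 0).obj (ModuleCat.of A A)) q)
  projective_P : ∀ i : ℤ, Module.Projective A (P.X i)
  boundedAbove_P : ∃ b : ℤ, P.IsStrictlyLE b
  quasiIso : QuasiIso δ
  isIso_le : ∃ k : ℤ, ∀ i : ℤ, i ≤ k → IsIso (γ.f i)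

/-! ### The bounded derived category and the singularity category -/

section Derived

variable (A : Type u) [CommRing A] [HasDerivedCategory.{w} (ModuleCat.{u} A)]

/-- The objects of the derived category with bounded finitely generated cohomology. -/
def boundedFG : ObjectProperty (DerivedCategory (ModuleCat.{u} A)) := fun X =>
  (∀ n : ℤ, Module.Finite A ((DerivedCategory.homologyFunctor (ModuleCat.{u} A) n).obj X)) ∧
    ∃ a b : ℤ, ∀ n : ℤ, (n < a ∨ b < n) →
      IsZero ((DerivedCategory.homologyFunctor (ModuleCat.{u} A) n).obj X)

/-- The perfect objects of the derived category: those isomorphic to a bounded complex of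
finitely generated projective modules. -/
def perfect : ObjectProperty (DerivedCategory (ModuleCat.{u} A)) := fun X =>
  ∃ K : CochainComplex (ModuleCat.{u} A) ℤ,
    (∀ n : ℤ, Module.Projective A (K.X n) ∧ Module.Finite A (K.X n)) ∧
    (∃ a b : ℤ, K.IsStrictlyGE a ∧ K.IsStrictlyLE b) ∧
    Nonempty (X ≅ DerivedCategory.Q.obj K)

variable {A} in
lemma boundedFG_Q_obj_iff (K : CochainComplex (ModuleCat.{u} A) ℤ) :
    boundedFG A (DerivedCategory.Q.obj K) ↔ HasBoundedFGCohomology K := by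
  have e (n : ℤ) : (DerivedCategory.homologyFunctor (ModuleCat.{u} A) n).obj
      (DerivedCategory.Q.obj K) ≅ K.homology n :=
    (DerivedCategory.homologyFunctorFactors (ModuleCat.{u} A) n).app K
  have h₁ (n : ℤ) : Module.Finite A ((DerivedCategory.homologyFunctor (ModuleCat.{u} A) n).obj
      (DerivedCategory.Q.obj K)) ↔ Module.Finite A (K.homology n) :=
    Module.Finite.equiv_iff (e n).toLinearEquiv
  have h₂ (n : ℤ) := (e n).isZero_iff
  simp only [boundedFG, HasBoundedFGCohomology, h₁, h₂]

instance : (boundedFG A).IsClosedUnderIsomorphisms where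
  of_iso e := by
    rintro ⟨h₁, a, b, h₂⟩
    refine ⟨fun n => ?_, a, b, fun n hn => (h₂ n hn).of_iso
      ((DerivedCategory.homologyFunctor (ModuleCat.{u} A) n).mapIso e.symm)⟩
    have := h₁ n
    exact Module.Finite.equiv ((DerivedCategory.homologyFunctor (ModuleCat.{u} A) n).mapIso e).toLinearEquiv

instance [IsNoetherianRing A] : (boundedFG A).IsTriangulated where
  exists_zero := by
    refine ⟨0, isZero_zero _, fun n => ?_, 0, 0, fun n _ => Functor.map_isZero _ (isZero_zero _)⟩
    have := ModuleCat.subsingleton_of_isZero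
      ((DerivedCategory.homologyFunctor (ModuleCat.{u} A) n).map_isZero (isZero_zero _))
    infer_instance
  isStableUnderShiftBy k :=
    { le_shift := by
        rintro X ⟨h₁, a, b, h₂⟩
        have e (n : ℤ) : (DerivedCategory.homologyFunctor (ModuleCat.{u} A) n).obj (X⟦k⟧) ≅
            (DerivedCategory.homologyFunctor (ModuleCat.{u} A) (k + n)).obj X :=
          ((DerivedCategory.homologyFunctor (ModuleCat.{u} A) 0).shiftIso k n (k + n) rfl).app X
        refine ⟨fun n => ?_, a - k, b - k, fun n hn =>
          (h₂ (k + n) (by lia)).of_iso (e n)⟩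
        have := h₁ (k + n)
        exact Module.Finite.equiv (e n).symm.toLinearEquiv }
  toIsTriangulatedClosed₂ := .mk' (by
    rintro T hT ⟨h₁, a, b, h₂⟩ ⟨h₁', a', b', h₂'⟩
    refine ⟨fun n => ?_, min a a', max b b', fun n hn => ?_⟩
    · have := h₁ n
      have := h₁' n
      have hex := DerivedCategory.HomologySequence.exact₂ T hT n
      rw [ShortComplex.moduleCat_exact_iff_range_eq_ker] at hex
      have := isNoetherian_of_range_eq_ker _ _ hex
      exact Module.IsNoetherian.finite _ _
    · exact (DerivedCategory.HomologySequence.exact₂ T hT n).isZero_of_both_zeros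
        ((h₂ n (by lia)).eq_of_src _ _) ((h₂' n (by lia)).eq_of_tgt _ _))

instance : (perfect A).IsClosedUnderIsomorphisms where
  of_iso e := by
    rintro ⟨K, h₁, h₂, ⟨e'⟩⟩
    exact ⟨K, h₁, h₂, ⟨e.symm ≪≫ e'⟩⟩

instance : (perfect A).IsStableUnderShift ℤ where
  isStableUnderShiftBy k :=
    { le_shift := by
        rintro X ⟨K, h₁, ⟨a, b, _, _⟩, ⟨e⟩⟩
        exact ⟨K⟦k⟧, fun n => h₁ (n + k),
          ⟨a - k, b - k, K.isStrictlyGE_shift a k _ (by lia),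
            K.isStrictlyLE_shift b k _ (by lia)⟩,
          ⟨(CategoryTheory.shiftFunctor _ k).mapIso e ≪≫ ((DerivedCategory.Q.commShiftIso k).app K).symm⟩⟩ }

instance : (perfect A).IsTriangulated where
  exists_zero := by
    refine ⟨0, isZero_zero _, 0, fun n => ?_, ⟨0, 0, ?_, ?_⟩,
      ⟨(isZero_zero _).iso (Functor.map_isZero _ (isZero_zero _))⟩⟩
    · have : Subsingleton ((0 : CochainComplex (ModuleCat.{u} A) ℤ).X n) :=
        ModuleCat.subsingleton_of_isZero
          ((HomologicalComplex.eval (ModuleCat.{u} A) (.up ℤ) n).map_isZero (isZero_zero _))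
      exact ⟨Module.Projective.of_free, inferInstance⟩
    · exact (CochainComplex.isStrictlyGE_iff _ _).2 fun i _ =>
        (HomologicalComplex.eval (ModuleCat.{u} A) (.up ℤ) i).map_isZero (isZero_zero _)
    · exact (CochainComplex.isStrictlyLE_iff _ _).2 fun i _ =>
        (HomologicalComplex.eval (ModuleCat.{u} A) (.up ℤ) i).map_isZero (isZero_zero _)
  toIsTriangulatedClosed₂ := by
    have : (perfect A).IsTriangulatedClosed₃ := .mk' (by
      rintro T hT ⟨K, h₁, ⟨a, b, _, _⟩, ⟨e⟩⟩ ⟨K', h₁', ⟨a', b', _, _⟩, ⟨e'⟩⟩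
      have (n : ℤ) : Projective (K.X n) :=
        (IsProjective.iff_projective (K.X n)).1 (h₁ n).1
      have := isKProjective_of_projective K b
      obtain ⟨f, hf⟩ : ∃ f : K ⟶ K', DerivedCategory.Q.map f = e.inv ≫ T.mor₁ ≫ e'.hom := by
        obtain ⟨g, hg⟩ := (IsKProjective.Qh_map_bijective K
          ((HomotopyCategory.quotient _ _).obj K')).2
            ((DerivedCategory.quotientCompQhIso _).hom.app K ≫ (e.inv ≫ T.mor₁ ≫ e'.hom) ≫
              (DerivedCategory.quotientCompQhIso _).inv.app K')
        obtain ⟨f, rfl⟩ := (HomotopyCategory.quotient _ _).map_surjective g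
        refine ⟨f, ?_⟩
        rw [← cancel_mono ((DerivedCategory.quotientCompQhIso _).inv.app K'),
          DerivedCategory.quotientCompQhIso_inv_naturality, hg]
        simp
      have i (n : ℤ) : (mappingCone f).X n ≅ K.X (n + 1) ⊞ K'.X n :=
        HomologicalComplex.homotopyCofiber.XIsoBiprod f n (n + 1) rfl
      have j (n : ℤ) : (mappingCone f).X n ≃ₗ[A] (K.X (n + 1) × K'.X n) :=
        (i n ≪≫ ModuleCat.biprodIsoProd _ _).toLinearEquiv
      refine ⟨mappingCone f, fun n => ?_, ⟨min (a - 1) a', max b b', ?_, ?_⟩, ⟨?_⟩⟩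
      · have := h₁ (n + 1)
        have := h₁' n
        have := (h₁ (n + 1)).1
        have := (h₁ (n + 1)).2
        have := (h₁' n).1
        have := (h₁' n).2
        exact ⟨Module.Projective.of_equiv (j n).symm, Module.Finite.equiv (j n).symm⟩
      · refine (CochainComplex.isStrictlyGE_iff _ _).2 fun n hn => ?_
        refine IsZero.of_iso ?_ (i n)
        rw [biprod_isZero_iff]
        exact ⟨K.isZero_of_isStrictlyGE a _ (by lia), K'.isZero_of_isStrictlyGE a' _ (by lia)⟩
      · refine (CochainComplex.isStrictlyLE_iff _ _).2 fun n hn => ?_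
        refine IsZero.of_iso ?_ (i n)
        rw [biprod_isZero_iff]
        exact ⟨K.isZero_of_isStrictlyLE b _ (by lia), K'.isZero_of_isStrictlyLE b' _ (by lia)⟩
      · exact Triangle.π₃.mapIso (isoTriangleOfIso₁₂ _ _ hT
          (DerivedCategory.mappingCone_triangle_distinguished f) e e' (by
            change T.mor₁ ≫ e'.hom = e.hom ≫ DerivedCategory.Q.map f
            rw [hf, Iso.hom_inv_id_assoc])))
    exact .of_isTriangulatedClosed₃

variable [IsNoetherianRing A]

/-- The bounded derived category `D^b(A)`: the full subcategory of the derived category of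
`A`-modules on the complexes with bounded finitely generated cohomology. -/
abbrev DerivedBounded := (boundedFG A).FullSubcategory

/-- The perfect objects of `D^b(A)`. -/
abbrev perfectBounded : ObjectProperty (DerivedBounded A) :=
  (perfect A).inverseImage (boundedFG A).ι

/-- The singularity category: the Verdier quotient of `D^b(A)` by the perfect complexes, that is,
the localization of `D^b(A)` at the morphisms whose cone is perfect. -/
abbrev Singularity := (perfectBounded A).trW.Localization

/-- The quotient functor `D^b(A) ⥤ D_sg(A)`. -/
abbrev toSingularity : DerivedBounded A ⥤ Singularity A := (perfectBounded A).trW.Q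

end Derived

/-! ### Ext and stable Ext -/

section Ext

variable {A : Type u} [CommRing A] [IsNoetherianRing A] [HasDerivedCategory.{w} (ModuleCat.{u} A)]

/-- A complex with bounded finitely generated cohomology as an object of `D^b(A)`. -/
abbrev toBounded (K : CochainComplex (ModuleCat.{u} A) ℤ) (hK : HasBoundedFGCohomology K) :
    DerivedBounded.{w} A :=
  ⟨DerivedCategory.Q.obj K, (boundedFG_Q_obj_iff K).2 hK⟩

/-- The morphism of `D^b(A)` given by a morphism of complexes. -/
def toBoundedMap {K L : CochainComplex (ModuleCat.{u} A) ℤ}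
    (hK : HasBoundedFGCohomology K) (hL : HasBoundedFGCohomology L) (f : K ⟶ L) :
    toBounded.{w} K hK ⟶ toBounded L hL :=
  ObjectProperty.homMk (DerivedCategory.Q.map f)

/-- `Ext^q_A(M, N) = Hom_{D^b(A)}(M, N[q])`. -/
abbrev ExtModule (q : ℤ) {M N : CochainComplex (ModuleCat.{u} A) ℤ}
    (hM : HasBoundedFGCohomology M) (hN : HasBoundedFGCohomology N) : Type _ :=
  toBounded.{w} M hM ⟶ toBounded (N⟦q⟧) (hN.shift q)

/-- The stable Ext-module `Hom_{D_sg(A)}(M, N[q])`. -/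
abbrev StableExt (q : ℤ) {M N : CochainComplex (ModuleCat.{u} A) ℤ}
    (hM : HasBoundedFGCohomology M) (hN : HasBoundedFGCohomology N) : Type _ :=
  (toSingularity A).obj (toBounded.{w} M hM) ⟶
    (toSingularity A).obj (toBounded (N⟦q⟧) (hN.shift q))

/-- The natural map from `Ext^q_A(M, N)` to the stable Ext-module, induced by the quotient
functor `D^b(A) ⥤ D_sg(A)`. -/
def extToStableExt (q : ℤ) {M N : CochainComplex (ModuleCat.{u} A) ℤ}
    (hM : HasBoundedFGCohomology M) (hN : HasBoundedFGCohomology N) :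
    ExtModule.{w} q hM hN →ₗ[A] StableExt.{w} q hM hN :=
  (toSingularity A).mapLinearMap A

/-- The map of stable Ext-modules induced by `g : N ⟶ N'`. -/
def stableExtPostcomp (q : ℤ) {M N N' : CochainComplex (ModuleCat.{u} A) ℤ}
    (hM : HasBoundedFGCohomology M) (hN : HasBoundedFGCohomology N)
    (hN' : HasBoundedFGCohomology N') (g : N ⟶ N') :
    StableExt.{w} q hM hN →ₗ[A] StableExt.{w} q hM hN' :=
  Linear.rightComp A _
    ((toSingularity A).map (toBoundedMap (hN.shift q) (hN'.shift q) (g⟦q⟧')))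

/-- The morphism of complexes `K ⟶ L[q]` given by a `q`-cocycle of `Hom_A(K, L)`, as an
`A`-linear map. -/
def cocycleToHom (K L : CochainComplex (ModuleCat.{u} A) ℤ) (q : ℤ) :
    HomComplex.Cocycle K L q →ₗ[A] (K ⟶ L⟦q⟧) where
  toFun z := HomComplex.Cocycle.equivHomShift.symm z
  map_add' := by simp
  map_smul' r z := by
    ext p : 1
    simp [HomComplex.Cocycle.homOf, HomComplex.Cocycle.equivHomShift_symm_apply]

/-- For a resolution `δ : P ⟶ M`, the canonical map from `H^q Hom_A(P, N)` to the morphisms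
`M ⟶ N[q]` in the derived category. It sends the class of a morphism of complexes `z : P ⟶ N[q]`
to the composition of `z` with the inverse of `δ`. -/
def homToDerived (q : ℤ) {P M : CochainComplex (ModuleCat.{u} A) ℤ} (δ : P ⟶ M) (hδ : QuasiIso δ)
    (N : CochainComplex (ModuleCat.{u} A) ℤ) :
    HomCohomology P N q →ₗ[A]
      ((DerivedCategory.Q.obj M : DerivedCategory.{w} (ModuleCat.{u} A)) ⟶
        DerivedCategory.Q.obj (N⟦q⟧)) :=
  Submodule.liftQ _
    (Linear.leftComp A _ (inv (DerivedCategory.Q.map δ)) ∘ₗ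
      DerivedCategory.Q.mapLinearMap A ∘ₗ cocycleToHom P N q)
    (by
      rintro z ⟨β, hβ⟩
      have h : (HomotopyCategory.quotient (ModuleCat.{u} A) (.up ℤ)).map
          (cocycleToHom P N q z) = 0 :=
        (HomComplex.CohomologyClass.toHom_mk_eq_zero_iff z).2 ⟨q - 1, by simp, β, hβ⟩
      rw [HomotopyCategory.quotient_map_eq_zero_iff] at h
      have h' := DerivedCategory.Q_map_eq_of_homotopy (C := ModuleCat.{u} A) h.some
      rw [Functor.map_zero] at h'
      simp [LinearMap.mem_ker, h'])

/-- For a resolution `δ : P ⟶ M`, the canonical map `H^q Hom_A(P, N) → Ext^q_A(M, N)`. -/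
def homToExt (q : ℤ) {P M N : CochainComplex (ModuleCat.{u} A) ℤ} (δ : P ⟶ M) (hδ : QuasiIso δ)
    (hM : HasBoundedFGCohomology M) (hN : HasBoundedFGCohomology N) :
    HomCohomology P N q →ₗ[A] ExtModule.{w} q hM hN where
  toFun x := ObjectProperty.homMk (homToDerived q δ hδ N x)
  map_add' x y := by
    rw [map_add]
    rfl
  map_smul' r x := by
    rw [map_smul]
    rfl

end Ext

end

end StableExtension

/-!
The proof compares both sides through the cohomological functor `Hom_K(T, -)`, where `K` is the
homotopy category. Every object of `D^b(A)` is represented by a bounded above complex, so that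
`D^b(A)` is the Verdier quotient of the homotopy category of bounded above complexes with bounded
finitely generated cohomology by its acyclic objects (`toDerivedBounded`). Two vanishing statements,
both proved by constructing a homotopy degree by degree, make `Hom_K(T, -)` descend to the
singularity category (`stableHomFunctor`):

* since `T` consists of projective modules, every morphism from `T` to a bounded above acyclic
  complex is homotopic to zero (`nonempty_homotopy_zero_of_projective`);
* since `Hom_A(T, A)` is acyclic, every morphism from `T` to a bounded complex of finitely generated
  projective modules is homotopic to zero (`nonempty_homotopy_zero_of_acyclic_dual`).

By the Yoneda argument, the class of `γ : T ⟶ P` in `Hom_K(T, P)` induces a natural transformation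
`Hom_{D_sg(A)}(P, -) ⟶ Hom_K(T, -)` (`stableEval`), and its compatibility with the quotient functor
is the commutative square of the theorem. It remains to see that this transformation is bijective
on every object (`stableEval_bijective`). Killing the top cohomology repeatedly by finite free
modules shows that, up to a morphism with perfect cone, every object of `D^b(A)` is a complex
vanishing in degrees `≥ k`, where `k` is as small as desired (`exists_trW_isLE`). If `γ` is an
isomorphism in degrees `≤ k`, then for such a complex `L` composition with `γ` induces a bijection
`Hom_K(P, L) ≃ Hom_K(T, L)` (`exists_comp_eq_of_isIso_f`, `nonempty_homotopy_zero_of_isIso_f`). As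
`P` is K-projective, every stable morphism from `P` is represented by a morphism of the homotopy
category from `P` to a complex of this kind, and the bijectivity follows.

Finally, `H^q Hom_A(K, L)` is the module of homotopy classes of morphisms from `K` to `L[q]`
(`homCohomologyEquiv`), which turns the bijection into the isomorphism of the theorem.
-/

namespace StableExtension

open CategoryTheory CategoryTheory.Limits CategoryTheory.Pretriangulated CochainComplex Opposite
open scoped ZeroObject

noncomputable section

/-! ### Homotopies constructed degree by degree -/

section Homotopies

open HomComplex

variable {C : Type*} [Category* C] [Abelian C]

/-- The inductive step: a homotopy up to degree `n` is prolonged to degree `n + 1` by adding one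
component in degree `n + 2`. The hypothesis `H` applies because the defect of the homotopy in
degree `n + 1` vanishes on boundaries. -/
lemma exists_extend_homotopy {K L : CochainComplex C ℤ} (f : K ⟶ L)
    (H : ∀ i j k : ℤ, i + 1 = j → j + 1 = k → ∀ φ : K.X j ⟶ L.X j, K.d i j ≫ φ = 0 →
      ∃ ψ : K.X k ⟶ L.X j, K.d j k ≫ ψ = φ)
    (α : Cochain K L (-1)) (n m : ℤ) (hnm : n + 1 = m)
    (hα : (δ (-1) 0 α).EqUpTo (Cochain.ofHom f) n) :
    ∃ (h : K.X (n + 2) ⟶ L.X (n + 1)),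
      (δ (-1) 0 (α + Cochain.single h (-1))).EqUpTo (Cochain.ofHom f) m := by
  subst hnm
  let u := f.f (n + 1) - α.v (n + 1) n (by lia) ≫ L.d n (n + 1) -
    K.d (n + 1) (n + 2) ≫ α.v (n + 2) (n + 1) (by lia)
  have hu : K.d n (n + 1) ≫ u = 0 := by
    have eq := hα n n (add_zero n) (by rfl)
    simp only [δ_v (-1) 0 (neg_add_cancel 1) α n n (add_zero _) (n - 1) (n + 1)
      (by lia) (by lia), Int.negOnePow_zero, one_smul, Cochain.ofHom_v] at eq
    simp only [u, Preadditive.comp_sub, HomologicalComplex.d_comp_d_assoc, zero_comp,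
      ← f.comm, ← eq, Preadditive.add_comp, Category.assoc, L.d_comp_d, comp_zero, zero_add,
      sub_self]
  obtain ⟨β, hβ⟩ := H n (n + 1) (n + 2) rfl (by lia) u hu
  refine ⟨β, fun p q hpq hp => ?_⟩
  obtain rfl : p = q := by lia
  obtain hp | rfl := hp.lt_or_eq
  · rw [δ_add, Cochain.add_v, hα p p (by lia) (by lia), add_eq_left,
      δ_v (-1) 0 (neg_add_cancel 1) _ p p hpq (p - 1) (p + 1) rfl rfl,
      Cochain.single_v_eq_zero _ _ _ _ _ (by lia),
      Cochain.single_v_eq_zero _ _ _ _ _ (by lia)]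
    simp
  · rw [δ_v (-1) 0 (neg_add_cancel 1) _ (n + 1) (n + 1) (by lia) n (n + 2)
      (by lia) (by lia), Cochain.add_v,
      Cochain.single_v_eq_zero _ _ _ _ _ (by lia)]
    simp [hβ, u]

open Cochain.InductionUp in
/-- A morphism of complexes which is zero in small degrees is homotopic to zero as soon as, in each
degree, every map `K.X j ⟶ L.X j` vanishing on boundaries extends along the differential of `K`:
the homotopy is built by increasing induction on the degree. -/
lemma nonempty_homotopy_zero_of_extends {K L : CochainComplex C ℤ} (f : K ⟶ L) (a : ℤ)
    (hf : ∀ p : ℤ, p < a → f.f p = 0)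
    (H : ∀ i j k : ℤ, i + 1 = j → j + 1 = k → ∀ φ : K.X j ⟶ L.X j, K.d i j ≫ φ = 0 →
      ∃ ψ : K.X k ⟶ L.X j, K.d j k ≫ ψ = φ) :
    Nonempty (Homotopy f 0) := by
  -- `X n` consists of the cochains that are homotopies up to degree `n + a - 1`.
  let X (n : ℕ) : Set (Cochain K L (-1)) :=
    Set.ofPred (fun α => (δ (-1) 0 α).EqUpTo (Cochain.ofHom f) (n + a - 1))
  let x₀ : X 0 := ⟨0, fun p q hpq hp ↦ by
    obtain rfl : p = q := by lia
    simp [hf p (by lia)]⟩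
  let φ (n : ℕ) (α : X n) : X (n + 1) :=
    ⟨_, (exists_extend_homotopy f H α.1 (n + a - 1) ((n + 1 : ℕ) + a - 1)
      (by lia) α.2).choose_spec⟩
  have hφ (k : ℕ) (x : X k) : (φ k x).1.EqUpTo x.1 (a + k) := fun p q hpq hp => by
    dsimp [φ]
    rw [add_eq_left, Cochain.single_v_eq_zero _ _ _ _ _ (by lia)]
  refine ⟨(Cochain.equivHomotopy f 0).symm ⟨limitSequence φ hφ x₀, ?_⟩⟩
  rw [Cochain.ofHom_zero, add_zero]
  ext n
  let k₀ := (n - a + 1).toNat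
  rw [← (sequence φ x₀ k₀).2 n n (add_zero n) (by lia),
    δ_v (-1) 0 (neg_add_cancel 1) _ n n (by lia) (n - 1) (n + 1) rfl (by lia),
    δ_v (-1) 0 (neg_add_cancel 1) _ n n (by lia) (n - 1) (n + 1) rfl (by lia),
    limitSequence_eqUpTo φ hφ x₀ k₀ n (n - 1) (by lia) (by lia),
    limitSequence_eqUpTo φ hφ x₀ k₀ (n + 1) n (by lia) (by lia)]

/-- Every morphism from a complex of projective objects to a bounded above acyclic complex is
homotopic to zero. No boundedness is asked of the source. -/
lemma nonempty_homotopy_zero_of_projective {K L : CochainComplex C ℤ} (f : K ⟶ L) (b : ℤ)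
    [L.IsStrictlyLE b] [∀ i, Projective (K.X i)] (hL : L.Acyclic) :
    Nonempty (Homotopy f 0) := by
  -- In the opposite category a bounded above target becomes a bounded below source.
  obtain ⟨h⟩ := nonempty_homotopy_zero_of_extends ((opEquivalence C).functor.map f.op) (-b)
    (fun p hp => (L.isZero_of_isStrictlyLE b (-p) (by lia)).op.eq_of_src _ _) (by
      intro i j k hij hjk φ hφ
      have hex := hL (-j)
      rw [HomologicalComplex.exactAt_iff' _ (-k) (-j) (-i) (by simp; lia) (by simp; lia)] at hex
      let φ' : K.X (-j) ⟶ L.X (-j) := φ.unop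
      have hφ' : φ' ≫ L.d (-j) (-i) = 0 := Quiver.Hom.op_inj hφ
      exact ⟨(hex.liftFromProjective φ' hφ').op,
        Quiver.Hom.unop_inj (hex.liftFromProjective_comp φ' hφ')⟩)
  exact ⟨homotopyUnop (h.trans (.ofEq (by simp)))⟩

end Homotopies

/-! ### Morphisms from a complex with acyclic dual, and complexes in low degrees -/

section CompleteResolutions

open HomComplex

variable {A : Type u} [CommRing A]

/-- If `Hom_A(T, A)` is acyclic, then so is `Hom_A(T, E)` for a finitely generated projective
module `E`. -/
lemma exists_extension_of_acyclic_dual {T : CochainComplex (ModuleCat.{u} A) ℤ}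
    (hT : ∀ q : ℤ, Subsingleton
      (HomCohomology T ((singleFunctor (ModuleCat.{u} A) 0).obj (ModuleCat.of A A)) q))
    (E : ModuleCat.{u} A) [Module.Finite A E] [Module.Projective A E]
    (i j k : ℤ) (hij : i + 1 = j) (hjk : j + 1 = k) (φ : T.X j ⟶ E) (hφ : T.d i j ≫ φ = 0) :
    ∃ ψ : T.X k ⟶ E, T.d j k ≫ ψ = φ := by
  have h₁ (χ : T.X j ⟶ ModuleCat.of A A) (hχ : T.d i j ≫ χ = 0) :
      ∃ ψ : T.X k ⟶ ModuleCat.of A A, T.d j k ≫ ψ = χ := by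
    have := hT (-j)
    rw [Submodule.Quotient.subsingleton_iff, Submodule.eq_top_iff'] at this
    exact (Cocycle.toSingleMk_mem_coboundaries_iff χ (q := 0) (n := -j) (by lia) i hij hχ k hjk).1
      ((mem_coboundaries_iff _ _ (by lia)).2 (this _))
  obtain ⟨n, r, s, hr, hs, hrs⟩ := Module.Finite.exists_comp_eq_id_of_projective A E
  choose ψ hψ using fun c : Fin n => h₁ (φ ≫ ModuleCat.ofHom (LinearMap.proj c ∘ₗ s)) (by
    rw [reassoc_of% hφ, zero_comp])
  refine ⟨ModuleCat.ofHom (r ∘ₗ LinearMap.pi fun c => (ψ c).hom), ?_⟩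
  ext x
  have : (LinearMap.pi fun c => (ψ c).hom) (T.d j k x) = s (φ x) := by
    ext c
    exact LinearMap.congr_fun (congrArg ModuleCat.Hom.hom (hψ c)) x
  simpa [this] using LinearMap.congr_fun hrs (φ x)

/-- If `Hom_A(T, A)` is acyclic, there are no nonzero maps up to homotopy from `T` to a bounded
below complex of finitely generated projective modules. -/
lemma nonempty_homotopy_zero_of_acyclic_dual {T K : CochainComplex (ModuleCat.{u} A) ℤ}
    (hT : ∀ q : ℤ, Subsingleton
      (HomCohomology T ((singleFunctor (ModuleCat.{u} A) 0).obj (ModuleCat.of A A)) q))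
    (hK : ∀ n : ℤ, Module.Projective A (K.X n) ∧ Module.Finite A (K.X n)) (a : ℤ)
    [K.IsStrictlyGE a] (f : T ⟶ K) : Nonempty (Homotopy f 0) :=
  nonempty_homotopy_zero_of_extends f a
    (fun p hp => (K.isZero_of_isStrictlyGE a p (by lia)).eq_of_tgt _ _)
    (fun i j k hij hjk φ hφ => by
      have := (hK j).1
      have := (hK j).2
      exact exists_extension_of_acyclic_dual hT (K.X j) i j k hij hjk φ hφ)

end CompleteResolutions

section LowTarget

variable {C : Type*} [Category* C] [Preadditive C] {T P K : CochainComplex C ℤ} (γ : T ⟶ P)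
  {k : ℤ} (hγ : ∀ i ≤ k, IsIso (γ.f i))

include hγ

/-- If `γ` is an isomorphism in degrees `≤ k`, every morphism from `T` to a complex concentrated in
these degrees factors through `γ`. -/
lemma exists_comp_eq_of_isIso_f [K.IsStrictlyLE k] (f : T ⟶ K) : ∃ g : P ⟶ K, γ ≫ g = f := by
  classical
  let g (i : ℤ) : P.X i ⟶ K.X i :=
    if hi : i ≤ k then haveI := hγ i hi; inv (γ.f i) ≫ f.f i else 0
  have hg (i : ℤ) (hi : i ≤ k) : γ.f i ≫ g i = f.f i := by
    have := hγ i hi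
    simp [g, hi]
  refine ⟨{ f := g, comm' := ?_ }, ?_⟩
  · rintro i j hij
    by_cases hj : j ≤ k
    · have hi : i ≤ k := by simp at hij; lia
      have := hγ i hi
      rw [← cancel_epi (γ.f i), reassoc_of% hg i hi, γ.comm_assoc, hg j hj, f.comm]
    · exact (K.isZero_of_isStrictlyLE k j (by lia)).eq_of_tgt _ _
  · ext i
    by_cases hi : i ≤ k
    · exact hg i hi
    · exact (K.isZero_of_isStrictlyLE k i (by lia)).eq_of_tgt _ _

/-- A null-homotopy of `γ ≫ g` in degree `i` involves `T.X (i + 1)`, which is why the target is asked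
to vanish already in degree `k`. -/
lemma nonempty_homotopy_zero_of_isIso_f [K.IsStrictlyLE (k - 1)] (g : P ⟶ K)
    (h : Homotopy (γ ≫ g) 0) : Nonempty (Homotopy g 0) := by
  classical
  refine ⟨{
    hom i j := if hi : i ≤ k then haveI := hγ i hi; inv (γ.f i) ≫ h.hom i j else 0
    zero i j hij := by simp [h.zero i j hij]
    comm i := ?_ }⟩
  by_cases hi : i ≤ k - 1
  · have h₀ := hγ i (by lia)
    have h₁ := hγ (i + 1) (by lia)
    have := h.comm i
    rw [← cancel_epi (γ.f i)]
    rw [dNext_eq _ (show (ComplexShape.up ℤ).Rel i (i + 1) from rfl),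
      prevD_eq _ (show (ComplexShape.up ℤ).Rel (i - 1) i by simp)] at this ⊢
    have hi' : i ≤ k := by lia
    have hi₁ : i + 1 ≤ k := by lia
    simpa [hi', hi₁] using this
  · exact (K.isZero_of_isStrictlyLE (k - 1) i (by lia)).eq_of_tgt _ _

end LowTarget

/-! ### The bounded derived category as a localization of bounded above complexes -/

section BoundedAbove

variable (C : Type*) [Category* C] [Abelian C]

/-- The objects of the homotopy category whose underlying complex is bounded above. (This property
is not closed under isomorphisms.) -/
def homotopyMinus : ObjectProperty (HomotopyCategory C (.up ℤ)) := fun X =>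
  ∃ b : ℤ, CochainComplex.IsStrictlyLE (K := X.as) b

variable {C} in
lemma homotopyMinus_quotient_obj_iff (K : CochainComplex C ℤ) :
    homotopyMinus C ((HomotopyCategory.quotient _ _).obj K) ↔ ∃ b : ℤ, K.IsStrictlyLE b :=
  Iff.rfl

instance : (homotopyMinus C).IsStableUnderShift ℤ where
  isStableUnderShiftBy n :=
    { le_shift K hK := by
        obtain ⟨K : CochainComplex _ _, rfl⟩ := K.quotient_obj_surjective
        rw [homotopyMinus_quotient_obj_iff] at hK
        obtain ⟨q, _⟩ := hK
        rw [ObjectProperty.prop_shift_iff, HomotopyCategory.shift_quotient_obj,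
          homotopyMinus_quotient_obj_iff]
        exact ⟨q - n, K.isStrictlyLE_shift q n (q - n) (by lia)⟩ }

instance : (homotopyMinus C).IsTriangulatedClosed₃ where
  ext₃' T hT h₁ h₂ := by
    obtain ⟨n₁, _⟩ := h₁
    obtain ⟨n₂, _⟩ := h₂
    obtain ⟨f : T.obj₁.as ⟶ T.obj₂.as, hf⟩ := (HomotopyCategory.quotient _ _).map_surjective T.mor₁
    refine ⟨(HomotopyCategory.quotient _ _).obj (mappingCone f), ?_,
      ⟨Triangle.π₃.mapIso (isoTriangleOfIso₁₂ T _ hT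
        (HomotopyCategory.mappingCone_triangleh_distinguished f)
        (Iso.refl _) (Iso.refl _) (by
          change T.mor₁ ≫ 𝟙 _ = 𝟙 _ ≫ (HomotopyCategory.quotient _ _).map f
          rw [hf, Category.comp_id]
          exact (Category.id_comp _).symm))⟩⟩
    rw [homotopyMinus_quotient_obj_iff]
    refine ⟨max n₁ n₂, (CochainComplex.isStrictlyLE_iff _ _).2 fun i hi => ?_⟩
    rw [mappingCone.isZero_X_iff]
    exact ⟨CochainComplex.isZero_of_isStrictlyLE _ n₁ _ (by lia),
      CochainComplex.isZero_of_isStrictlyLE _ n₂ _ (by lia)⟩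

instance : (homotopyMinus C).IsTriangulated where
  exists_zero := ⟨(HomotopyCategory.quotient _ _).obj 0, Functor.map_isZero _ (isZero_zero _), by
    rw [homotopyMinus_quotient_obj_iff]
    exact ⟨0, inferInstance⟩⟩
  toIsTriangulatedClosed₂ := .of_isTriangulatedClosed₃

end BoundedAbove

section Localization

lemma HasBoundedFGCohomology.of_acyclic {A : Type u} [CommRing A]
    {K : CochainComplex (ModuleCat.{u} A) ℤ} (hK : K.Acyclic) : HasBoundedFGCohomology K := by
  refine ⟨fun n => ?_, 0, 0, fun n _ => (hK n).isZero_homology⟩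
  have := ModuleCat.subsingleton_of_isZero (hK n).isZero_homology
  infer_instance

variable (A : Type u) [CommRing A] [HasDerivedCategory.{w} (ModuleCat.{u} A)]

variable {A} in
lemma boundedFG_Qh_obj_quotient_obj_iff (K : CochainComplex (ModuleCat.{u} A) ℤ) :
    boundedFG.{w} A (DerivedCategory.Qh.obj ((HomotopyCategory.quotient _ _).obj K)) ↔
      HasBoundedFGCohomology K :=
  ((boundedFG A).prop_iff_of_iso ((DerivedCategory.quotientCompQhIso _).app K)).trans
    (boundedFG_Q_obj_iff K)

/-- The objects of the homotopy category given by a bounded above complex with bounded finitely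
generated cohomology. -/
def homotopyMinusFG : ObjectProperty (HomotopyCategory (ModuleCat.{u} A) (.up ℤ)) :=
  homotopyMinus (ModuleCat.{u} A) ⊓ (boundedFG.{w} A).inverseImage DerivedCategory.Qh

variable {A} in
lemma boundedFG_Qh_obj (X : (homotopyMinusFG.{w} A).FullSubcategory) :
    boundedFG.{w} A (((homotopyMinusFG A).ι ⋙ DerivedCategory.Qh).obj X) :=
  X.property.2

/-- The homotopy category of bounded above complexes with bounded finitely generated
cohomology. -/
abbrev HomotopyMinusFG := (homotopyMinusFG.{w} A).FullSubcategory

/-- The localization functor from the homotopy category of bounded above complexes with bounded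
finitely generated cohomology to `D^b(A)`. -/
def toDerivedBounded : HomotopyMinusFG.{w} A ⥤ DerivedBounded.{w} A :=
  (boundedFG A).lift ((homotopyMinusFG A).ι ⋙ DerivedCategory.Qh)
    boundedFG_Qh_obj

variable [IsNoetherianRing A]

instance : (homotopyMinusFG.{w} A).IsTriangulated := by
  dsimp only [homotopyMinusFG]
  infer_instance

instance : (toDerivedBounded.{w} A).CommShift ℤ :=
  inferInstanceAs (((boundedFG A).lift ((homotopyMinusFG A).ι ⋙ DerivedCategory.Qh)
    boundedFG_Qh_obj).CommShift ℤ)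

instance : (toDerivedBounded.{w} A).IsTriangulated :=
  inferInstanceAs (((boundedFG A).lift ((homotopyMinusFG A).ι ⋙ DerivedCategory.Qh)
    boundedFG_Qh_obj).IsTriangulated)

/-- A morphism from a complex in degrees `≤ n` to an acyclic complex factors through the truncation in
degrees `≤ n` of its target, which is again acyclic. -/
instance : (homotopyMinusFG.{w} A).IsVerdierLeftLocalizing
    (HomotopyCategory.subcategoryAcyclic (ModuleCat.{u} A)) where
  fac {K L} φ hK hL := by
    obtain ⟨K : CochainComplex _ _, rfl⟩ := HomotopyCategory.quotient_obj_surjective K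
    obtain ⟨L : CochainComplex _ _, rfl⟩ := HomotopyCategory.quotient_obj_surjective L
    obtain ⟨n, hn : K.IsStrictlyLE n⟩ := hK.1
    obtain ⟨φ, rfl⟩ := (HomotopyCategory.quotient _ _).map_surjective φ
    rw [HomotopyCategory.quotient_obj_mem_subcategoryAcyclic_iff_acyclic] at hL
    have hL' : (L.truncLE n).Acyclic := hL.truncLE _
    refine ⟨(HomotopyCategory.quotient _ _).obj (L.truncLE n),
      (HomotopyCategory.quotient _ _).map (inv (K.ιTruncLE n) ≫ CochainComplex.truncLEMap φ n),
      (HomotopyCategory.quotient _ _).map (L.ιTruncLE n), ⟨⟨n, ?_⟩, ?_⟩, ?_, ?_⟩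
    · exact inferInstanceAs ((L.truncLE n).IsStrictlyLE n)
    · exact (boundedFG_Qh_obj_quotient_obj_iff _).2 (.of_acyclic hL')
    · rwa [HomotopyCategory.quotient_obj_mem_subcategoryAcyclic_iff_acyclic]
    · simp [← Functor.map_comp]

instance : (toDerivedBounded.{w} A).EssSurj where
  mem_essImage := by
    rintro ⟨X, hX⟩
    obtain ⟨h₁, a, b, h₂⟩ := id hX
    have : X.IsLE b := (DerivedCategory.isLE_iff X b).2 fun i hi => h₂ i (.inr hi)
    obtain ⟨K, e, hK⟩ := this.le
    let e' := (DerivedCategory.quotientCompQhIso _).app K ≪≫ e.symm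
    exact ⟨⟨(HomotopyCategory.quotient _ _).obj K, ⟨b, hK⟩, (boundedFG A).prop_of_iso e'.symm hX⟩,
      ⟨(boundedFG A).ι.preimageIso e'⟩⟩

/-- The acyclic objects of `HomotopyMinusFG A`. -/
abbrev acyclicMinusFG : ObjectProperty (HomotopyMinusFG.{w} A) :=
  (HomotopyCategory.subcategoryAcyclic (ModuleCat.{u} A)).inverseImage (homotopyMinusFG.{w} A).ι

instance : (toDerivedBounded.{w} A).IsLocalization (acyclicMinusFG.{w} A).trW :=
  ((homotopyMinusFG.{w} A).triangulatedLocalizerMorphism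
    (HomotopyCategory.subcategoryAcyclic _)).isLocalization_of_isLocalizedFullyFaithful
      (L₂ := DerivedCategory.Qh) (F := (boundedFG A).ι) (Iso.refl _)

instance : (toDerivedBounded.{w} A).mapArrow.EssSurj :=
  Localization.essSurj_mapArrow _ (acyclicMinusFG.{w} A).trW

end Localization

/-! ### The functor represented by a complex on the singularity category -/

section HomologicalFunctors

variable {C D : Type*} [Category* C] [Category* D] [HasZeroObject C] [HasShift C ℤ]
  [Preadditive C] [∀ n : ℤ, (CategoryTheory.shiftFunctor C n).Additive] [Pretriangulated C]
  [Abelian D]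

/-- A homological functor vanishing on a shift-stable class of objects inverts the morphisms whose
cone is in this class. -/
lemma isInvertedBy_trW_of_isZero (F : C ⥤ D) [F.IsHomological] (Q : ObjectProperty C)
    [Q.IsStableUnderShift ℤ] (hF : ∀ X, Q X → IsZero (F.obj X)) : Q.trW.IsInvertedBy F := by
  intro X Y f hf
  obtain ⟨Z, g, h, hT, hZ⟩ := (Q.trW_iff f).1 hf
  have h₁ := F.map_distinguished_exact _ (inv_rot_of_distTriang _ hT)
  have h₂ := F.map_distinguished_exact _ hT
  have : Mono (F.map f) := h₁.mono_g ((hF _ (Q.le_shift (-1) _ hZ)).eq_of_src _ _)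
  have : Epi (F.map f) := h₂.epi_f ((hF _ hZ).eq_of_tgt _ _)
  exact isIso_of_mono_of_epi _

end HomologicalFunctors

section TateFunctor

variable {A : Type u} [CommRing A] [IsNoetherianRing A] [HasDerivedCategory.{w} (ModuleCat.{u} A)]
  (T : CochainComplex (ModuleCat.{u} A) ℤ)

/-- The functor sending a bounded above complex to the group of homotopy classes of morphisms
from `T`. -/
def homFunctor : HomotopyMinusFG.{w} A ⥤ AddCommGrpCat.{u} :=
  (homotopyMinusFG.{w} A).ι ⋙ preadditiveCoyoneda.obj (op ((HomotopyCategory.quotient _ _).obj T))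

instance : (homFunctor.{w} T).IsHomological := by
  dsimp only [homFunctor]
  infer_instance

lemma homFunctor_isInvertedBy (hT : ∀ i, Module.Projective A (T.X i)) :
    (acyclicMinusFG.{w} A).trW.IsInvertedBy (homFunctor.{w} T) := by
  refine isInvertedBy_trW_of_isZero _ _ ?_
  rintro ⟨X, ⟨b, hb⟩, h⟩ hX
  obtain ⟨K : CochainComplex _ _, rfl⟩ := HomotopyCategory.quotient_obj_surjective X
  replace hX := (HomotopyCategory.quotient_obj_mem_subcategoryAcyclic_iff_acyclic _).1 hX
  rw [AddCommGrpCat.isZero_iff_subsingleton]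
  refine subsingleton_of_forall_eq 0 fun f => ?_
  obtain ⟨f, rfl⟩ := (HomotopyCategory.quotient _ _).map_surjective f
  have : K.IsStrictlyLE b := hb
  have (n : ℤ) : Projective (T.X n) := (IsProjective.iff_projective (T.X n)).1 (hT n)
  obtain ⟨H⟩ := nonempty_homotopy_zero_of_projective f b hX
  exact (HomotopyCategory.eq_of_homotopy _ _ H).trans (Functor.map_zero _ _ _)

variable (hT : ∀ i, Module.Projective A (T.X i))

/-- The functor induced by `homFunctor T` on `D^b(A)`, for a complex `T` of projective modules. -/
def derivedHomFunctor : DerivedBounded.{w} A ⥤ AddCommGrpCat.{u} :=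
  Localization.lift (homFunctor T) (homFunctor_isInvertedBy T hT) (toDerivedBounded A)

/-- `derivedHomFunctor T hT` extends `homFunctor T`. -/
def derivedHomFunctorIso :
    toDerivedBounded.{w} A ⋙ derivedHomFunctor T hT ≅ homFunctor.{w} T :=
  Localization.fac _ _ _

instance : (derivedHomFunctor.{w} T hT).IsHomological :=
  Functor.isHomological_of_localization (toDerivedBounded A) _ _ (derivedHomFunctorIso T hT)

lemma derivedHomFunctor_isInvertedBy
    (hT' : ∀ q : ℤ, Subsingleton
      (HomCohomology T ((singleFunctor (ModuleCat.{u} A) 0).obj (ModuleCat.of A A)) q)) :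
    (perfectBounded.{w} A).trW.IsInvertedBy (derivedHomFunctor.{w} T hT) := by
  refine isInvertedBy_trW_of_isZero _ _ ?_
  rintro ⟨X, hX⟩ ⟨K, hK, ⟨a, b, _, _⟩, ⟨e⟩⟩
  let Y : HomotopyMinusFG.{w} A := ⟨(HomotopyCategory.quotient _ _).obj K, ⟨b, ‹K.IsStrictlyLE b›⟩,
    (boundedFG A).prop_of_iso (e ≪≫ ((DerivedCategory.quotientCompQhIso _).app K).symm) hX⟩
  let e' : (toDerivedBounded A).obj Y ≅ ⟨X, hX⟩ := (boundedFG A).ι.preimageIso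
    ((DerivedCategory.quotientCompQhIso _).app K ≪≫ e.symm)
  refine IsZero.of_iso ?_ ((derivedHomFunctor.{w} T hT).mapIso e'.symm ≪≫
    (derivedHomFunctorIso T hT).app Y)
  rw [AddCommGrpCat.isZero_iff_subsingleton]
  refine subsingleton_of_forall_eq 0 fun f => ?_
  obtain ⟨f, rfl⟩ := (HomotopyCategory.quotient _ _).map_surjective f
  obtain ⟨H⟩ := nonempty_homotopy_zero_of_acyclic_dual hT' hK a f
  exact (HomotopyCategory.eq_of_homotopy _ _ H).trans (Functor.map_zero _ _ _)

variable (hT' : ∀ q : ℤ, Subsingleton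
    (HomCohomology T ((singleFunctor (ModuleCat.{u} A) 0).obj (ModuleCat.of A A)) q))

/-- The functor induced by `homFunctor T` on the singularity category, for a complex `T` of
projective modules such that `Hom_A(T, A)` is acyclic. -/
def stableHomFunctor : Singularity.{w} A ⥤ AddCommGrpCat.{u} :=
  Localization.lift (derivedHomFunctor T hT) (derivedHomFunctor_isInvertedBy T hT hT')
    (toSingularity A)

/-- The functor from the homotopy category of bounded above complexes to the singularity
category. -/
abbrev homotopyToSingularity : HomotopyMinusFG.{w} A ⥤ Singularity.{w} A :=
  toDerivedBounded A ⋙ toSingularity A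

/-- `stableHomFunctor T hT hT'` extends `homFunctor T`. -/
def stableHomFunctorIso :
    homotopyToSingularity ⋙ stableHomFunctor T hT hT' ≅ homFunctor.{w} T :=
  Functor.associator _ _ _ ≪≫ Functor.isoWhiskerLeft _ (Localization.fac _ _ _) ≪≫
    derivedHomFunctorIso T hT

instance : (stableHomFunctor.{w} T hT hT').Additive := by
  rw [Localization.functor_additive_iff (toSingularity A) (perfectBounded A).trW]
  exact Functor.additive_of_iso (F := derivedHomFunctor.{w} T hT) (Localization.fac _ _ _).symm

end TateFunctor

/-! ### Killing cohomology in high degrees by perfect complexes -/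

section Approximation

/-- A morphism from a projective object to `H^b(K)` lifts to the cycles, hence to a morphism of
complexes. -/
lemma exists_single_epi_homologyMap {C : Type*} [Category* C] [Abelian C]
    (K : CochainComplex C ℤ) (b : ℤ) {E : C} [Projective E] (e : E ⟶ K.homology b) [Epi e] :
    ∃ f : (HomologicalComplex.single C (.up ℤ) b).obj E ⟶ K,
      Epi (HomologicalComplex.homologyMap f b) := by
  let e' : E ⟶ K.cycles b := Projective.factorThru e (K.homologyπ b)
  have he' : e' ≫ K.homologyπ b = e := Projective.factorThru_comp _ _
  let f : (HomologicalComplex.single C (.up ℤ) b).obj E ⟶ K :=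
    HomologicalComplex.mkHomFromSingle (e' ≫ K.iCycles b) (by simp)
  have h₁ : (HomologicalComplex.singleObjCyclesSelfIso (.up ℤ) b E).inv ≫
      HomologicalComplex.cyclesMap f b = e' := by
    rw [← cancel_mono (K.iCycles b), Category.assoc, HomologicalComplex.cyclesMap_i,
      HomologicalComplex.singleObjCyclesSelfIso_inv_iCycles_assoc,
      HomologicalComplex.mkHomFromSingle_f, Iso.inv_hom_id_assoc]
  have h₂ : ((HomologicalComplex.singleObjCyclesSelfIso (.up ℤ) b E).inv ≫
      HomologicalComplex.homologyπ _ b) ≫ HomologicalComplex.homologyMap f b = e := by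
    rw [Category.assoc, HomologicalComplex.homologyπ_naturality, reassoc_of% h₁, he']
  refine ⟨f, ?_⟩
  have : Epi (((HomologicalComplex.singleObjCyclesSelfIso (.up ℤ) b E).inv ≫
      HomologicalComplex.homologyπ _ b) ≫ HomologicalComplex.homologyMap f b) := by
    rw [h₂]
    infer_instance
  exact epi_of_epi ((HomologicalComplex.singleObjCyclesSelfIso (.up ℤ) b E).inv ≫
    HomologicalComplex.homologyπ _ b) _

lemma hasBoundedFGCohomology_of_finite {A : Type u} [CommRing A] [IsNoetherianRing A]
    {K : CochainComplex (ModuleCat.{u} A) ℤ} (a b : ℤ)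
    [K.IsStrictlyGE a] [K.IsStrictlyLE b] (hK : ∀ n, Module.Finite A (K.X n)) :
    HasBoundedFGCohomology K := by
  refine ⟨fun n => ?_, a, b, ?_⟩
  · have := hK n
    have h₁ : Module.Finite A (K.cycles n) := Module.Finite.of_injective (K.iCycles n).hom
      ((ModuleCat.mono_iff_injective _).1 inferInstance)
    exact Module.Finite.of_surjective (K.homologyπ n).hom
      ((ModuleCat.epi_iff_surjective _).1 inferInstance)
  · rintro n (hn | hn)
    · exact (K.exactAt_of_isGE a n hn).isZero_homology
    · exact (K.exactAt_of_isLE b n hn).isZero_homology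

variable {A : Type u} [CommRing A] [HasDerivedCategory.{w} (ModuleCat.{u} A)]

lemma perfect_Q_obj_single (E : ModuleCat.{u} A) [Module.Finite A E] [Module.Projective A E]
    (b : ℤ) :
    perfect.{w} A (DerivedCategory.Q.obj ((HomologicalComplex.single _ (.up ℤ) b).obj E)) := by
  refine ⟨_, fun n => ?_, ⟨b, b, ?_, ?_⟩, ⟨Iso.refl _⟩⟩
  · by_cases hn : n = b
    · subst hn
      let i := (HomologicalComplex.singleObjXSelf (.up ℤ) n E).toLinearEquiv
      exact ⟨.of_equiv i.symm, .equiv i.symm⟩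
    · have := ModuleCat.subsingleton_of_isZero
        (HomologicalComplex.isZero_single_obj_X (.up ℤ) b E n hn)
      exact ⟨.of_free, inferInstance⟩
  · exact inferInstanceAs (((CochainComplex.singleFunctor _ b).obj E).IsStrictlyGE b)
  · exact inferInstanceAs (((CochainComplex.singleFunctor _ b).obj E).IsStrictlyLE b)

variable [IsNoetherianRing A]

lemma perfect_le_boundedFG : perfect.{w} A ≤ boundedFG.{w} A := by
  rintro X ⟨K, hK, ⟨a, b, _, _⟩, ⟨e⟩⟩
  exact (boundedFG A).prop_of_iso e.symm ((boundedFG_Q_obj_iff K).2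
    (hasBoundedFGCohomology_of_finite a b fun n => (hK n).2))

/-- Killing the top cohomology: a finite free module in degree `b` mapping onto `H^b` has a cone
with cohomology in degrees `< b`. -/
lemma exists_trW_isLE_sub_one (X : DerivedBounded.{w} A) (b : ℤ) [X.obj.IsLE b] :
    ∃ (Y : DerivedBounded.{w} A) (s : X ⟶ Y),
      (perfectBounded A).trW s ∧ Y.obj.IsLE (b - 1) := by
  obtain ⟨X, hX⟩ := X
  obtain ⟨K, ⟨i⟩⟩ : ∃ K, Nonempty (DerivedCategory.Q.obj K ≅ X) :=
    ⟨_, ⟨DerivedCategory.Q.objObjPreimageIso X⟩⟩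
  have hK : boundedFG A (DerivedCategory.Q.obj K) := (boundedFG A).prop_of_iso i.symm hX
  have hK' := ((boundedFG_Q_obj_iff K).1 hK).1 b
  obtain ⟨n, p, hp⟩ := Module.Finite.exists_fin' A (K.homology b)
  let E := ModuleCat.of A (Fin n → A)
  have : Projective E := (IsProjective.iff_projective E).1 inferInstance
  let e : E ⟶ K.homology b := ModuleCat.ofHom p
  have : Epi e := (ModuleCat.epi_iff_surjective e).2 hp
  obtain ⟨f, hf⟩ := exists_single_epi_homologyMap K b e
  have hE := perfect_Q_obj_single.{w} E b
  obtain ⟨Y, g, h, hT⟩ := distinguished_cocone_triangle (DerivedCategory.Q.map f ≫ i.hom)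
  have hY : boundedFG A Y :=
    (boundedFG A).ext_of_isTriangulatedClosed₃ _ hT (perfect_le_boundedFG _ hE) hX
  refine ⟨⟨Y, hY⟩, (boundedFG A).homMk g, ?_, ?_⟩
  · rw [ObjectProperty.trW_inverseImage_ι_iff, ObjectProperty.trW_iff']
    exact ⟨_, _, _, hT, perfect_le_boundedFG _ hE, hE⟩
  · have h₀ (m : ℤ) (hm : m ≠ b) : IsZero ((DerivedCategory.homologyFunctor _ m).obj
        (DerivedCategory.Q.obj ((HomologicalComplex.single _ (.up ℤ) b).obj E))) :=
      (HomologicalComplex.isZero_single_obj_homology (.up ℤ) b E m hm).of_iso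
        ((DerivedCategory.homologyFunctorFactors _ m).app _)
    refine (DerivedCategory.isLE_iff Y (b - 1)).2 fun m hm => ?_
    have h₁ : (DerivedCategory.homologyFunctor _ m).map g = 0 := by
      refine (DerivedCategory.HomologySequence.epi_homologyMap_mor₁_iff _ hT m).1 ?_
      obtain rfl | hm' := eq_or_ne m b
      · have : Epi ((DerivedCategory.homologyFunctor _ m).map (DerivedCategory.Q.map f)) :=
          ((MorphismProperty.epimorphisms _).arrow_mk_iso_iff
            (Arrow.isoOfNatIso (DerivedCategory.homologyFunctorFactors _ m) (Arrow.mk f))).2 hf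
        have : Epi ((DerivedCategory.homologyFunctor _ m).map
            (DerivedCategory.Q.map f ≫ i.hom)) := by
          rw [Functor.map_comp]
          infer_instance
        exact this
      · exact ⟨fun _ _ _ => (DerivedCategory.isZero_of_isLE X b m (by lia)).eq_of_src _ _⟩
    refine (DerivedCategory.HomologySequence.exact₃ _ hT m (m + 1)).isZero_of_both_zeros h₁
      ((h₀ (m + 1) (by lia)).eq_of_tgt _ _)

lemma exists_trW_isLE (X : DerivedBounded.{w} A) (k : ℤ) :
    ∃ (Y : DerivedBounded.{w} A) (s : X ⟶ Y), (perfectBounded A).trW s ∧ Y.obj.IsLE k := by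
  obtain ⟨_, a, b, h⟩ := id X.property
  have (n : ℕ) : ∃ (Y : DerivedBounded.{w} A) (s : X ⟶ Y),
      (perfectBounded A).trW s ∧ Y.obj.IsLE (b - n) := by
    induction n with
    | zero =>
      refine ⟨X, 𝟙 X, (perfectBounded A).trW.id_mem X,
        (DerivedCategory.isLE_iff _ _).2 fun i hi => ?_⟩
      exact h i (.inr (by simpa using hi))
    | succ n hn =>
      obtain ⟨Y, s, hs, _⟩ := hn
      obtain ⟨Z, t, ht, hZ⟩ := exists_trW_isLE_sub_one Y (b - n)
      refine ⟨Z, s ≫ t, (perfectBounded A).trW.comp_mem _ _ hs ht, ?_⟩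
      rwa [Nat.cast_succ, ← sub_sub]
  obtain ⟨Y, s, hs, hY⟩ := this (b - k).toNat
  exact ⟨Y, s, hs, (DerivedCategory.isLE_iff _ _).2 fun i hi =>
    (DerivedCategory.isLE_iff _ _).1 hY i (by lia)⟩

end Approximation

/-! ### Stable morphisms from a projective resolution -/

section Comparison

variable {A : Type u} [CommRing A] [HasDerivedCategory.{w} (ModuleCat.{u} A)]

/-- A bounded above complex with bounded finitely generated cohomology as an object of
`HomotopyMinusFG A`. -/
abbrev toMinusFG (K : CochainComplex (ModuleCat.{u} A) ℤ) (hK : HasBoundedFGCohomology K)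
    (hb : ∃ b : ℤ, K.IsStrictlyLE b) : HomotopyMinusFG.{w} A :=
  ⟨(HomotopyCategory.quotient _ _).obj K, hb, (boundedFG_Qh_obj_quotient_obj_iff K).2 hK⟩

/-- The morphism of `HomotopyMinusFG A` given by a morphism of complexes. -/
abbrev toMinusFGMap {K L : CochainComplex (ModuleCat.{u} A) ℤ} (hK : HasBoundedFGCohomology K)
    (hL : HasBoundedFGCohomology L) (hb : ∃ b : ℤ, K.IsStrictlyLE b)
    (hb' : ∃ b : ℤ, L.IsStrictlyLE b) (f : K ⟶ L) :
    toMinusFG.{w} K hK hb ⟶ toMinusFG L hL hb' :=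
  ObjectProperty.homMk ((HomotopyCategory.quotient _ _).map f)

/-- The object of `D^b(A)` attached to a bounded above complex, computed in two ways. -/
def toDerivedBoundedObjIso (K : CochainComplex (ModuleCat.{u} A) ℤ)
    (hK : HasBoundedFGCohomology K) (hb : ∃ b : ℤ, K.IsStrictlyLE b) :
    (toDerivedBounded A).obj (toMinusFG.{w} K hK hb) ≅ toBounded K hK :=
  (boundedFG A).isoMk ((DerivedCategory.quotientCompQhIso _).app K)

lemma toDerivedBoundedObjIso_hom_naturality {K L : CochainComplex (ModuleCat.{u} A) ℤ}
    (hK : HasBoundedFGCohomology K) (hL : HasBoundedFGCohomology L)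
    (hb : ∃ b : ℤ, K.IsStrictlyLE b) (hb' : ∃ b : ℤ, L.IsStrictlyLE b) (f : K ⟶ L) :
    (toDerivedBounded A).map (toMinusFGMap.{w} hK hL hb hb' f) ≫
        (toDerivedBoundedObjIso L hL hb').hom =
      (toDerivedBoundedObjIso K hK hb).hom ≫ toBoundedMap hK hL f := by
  apply (boundedFG A).ι.map_injective
  exact DerivedCategory.quotientCompQhIso_hom_naturality f

lemma toDerivedBounded_map_surjective {P : CochainComplex (ModuleCat.{u} A) ℤ}
    (hP : HasBoundedFGCohomology P) (hb : ∃ b : ℤ, P.IsStrictlyLE b) [P.IsKProjective]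
    {Y : HomotopyMinusFG.{w} A}
    (f : (toDerivedBounded A).obj (toMinusFG P hP hb) ⟶ (toDerivedBounded A).obj Y) :
    ∃ g : toMinusFG P hP hb ⟶ Y, (toDerivedBounded A).map g = f := by
  obtain ⟨g, hg⟩ := (IsKProjective.Qh_map_bijective P Y.obj).2 f.hom
  exact ⟨ObjectProperty.homMk g, by ext; exact hg⟩

variable [IsNoetherianRing A]

variable {T P : CochainComplex (ModuleCat.{u} A) ℤ} (γ : T ⟶ P)
  (hT : ∀ i, Module.Projective A (T.X i))
  (hT' : ∀ q : ℤ, Subsingleton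
    (HomCohomology T ((singleFunctor (ModuleCat.{u} A) 0).obj (ModuleCat.of A A)) q))
  (hP : HasBoundedFGCohomology P) (hb : ∃ b : ℤ, P.IsStrictlyLE b)

/-- The map from stable morphisms out of `P` given by evaluation at the class of `γ : T ⟶ P`. -/
def stableEval (X : Singularity.{w} A) :
    (homotopyToSingularity.obj (toMinusFG.{w} P hP hb) ⟶ X) →+
      (stableHomFunctor.{w} T hT hT').obj X where
  toFun a := (stableHomFunctor.{w} T hT hT').map a
    ((stableHomFunctorIso T hT hT').inv.app (toMinusFG.{w} P hP hb)
      ((HomotopyCategory.quotient _ _).map γ))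
  map_zero' := by simp
  map_add' a b := by simp [Functor.map_add]

lemma stableEval_comp {X Y : Singularity.{w} A}
    (a : homotopyToSingularity.obj (toMinusFG.{w} P hP hb) ⟶ X) (b : X ⟶ Y) :
    stableEval γ hT hT' hP hb Y (a ≫ b) =
      (stableHomFunctor.{w} T hT hT').map b (stableEval γ hT hT' hP hb X a) := by
  simp [stableEval]

lemma stableEval_map {Y : HomotopyMinusFG.{w} A} (f : toMinusFG.{w} P hP hb ⟶ Y) :
    stableEval γ hT hT' hP hb _ (homotopyToSingularity.map f) =
      (stableHomFunctorIso.{w} T hT hT').inv.app Y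
        ((HomotopyCategory.quotient _ _).map γ ≫ f.hom) := by
  have := (stableHomFunctorIso.{w} T hT hT').inv.naturality f
  exact (ConcreteCategory.congr_hom this ((HomotopyCategory.quotient _ _).map γ)).symm

/-- On morphisms coming from the homotopy category, `stableEval` is composition with `γ`. -/
lemma stableHomFunctorIso_hom_app_stableEval_map {Y : HomotopyMinusFG.{w} A}
    (f : toMinusFG.{w} P hP hb ⟶ Y) :
    (stableHomFunctorIso.{w} T hT hT').hom.app Y
        (stableEval γ hT hT' hP hb _ (homotopyToSingularity.map f)) =
      (HomotopyCategory.quotient _ _).map γ ≫ f.hom := by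
  rw [stableEval_map]
  exact ((stableHomFunctorIso.{w} T hT hT').app Y).inv_hom_id_apply _

variable {k : ℤ} (hγ : ∀ i ≤ k, IsIso (γ.f i))

include hγ in
lemma exists_stableEval_map_eq {K : CochainComplex (ModuleCat.{u} A) ℤ}
    (hK : HasBoundedFGCohomology K) (hKk : K.IsStrictlyLE (k - 1))
    (x : (stableHomFunctor.{w} T hT hT').obj
      (homotopyToSingularity.obj (toMinusFG.{w} K hK ⟨_, hKk⟩))) :
    ∃ f : toMinusFG.{w} P hP hb ⟶ toMinusFG.{w} K hK ⟨_, hKk⟩,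
      stableEval γ hT hT' hP hb _ (homotopyToSingularity.map f) = x := by
  let i := (stableHomFunctorIso.{w} T hT hT').app (toMinusFG.{w} K hK ⟨_, hKk⟩)
  obtain ⟨y, hy⟩ := (HomotopyCategory.quotient _ _).map_surjective (i.hom x)
  have := K.isStrictlyLE_of_le (k - 1) k (by lia)
  obtain ⟨f, hf⟩ := exists_comp_eq_of_isIso_f γ hγ y
  refine ⟨toMinusFGMap hP hK hb ⟨_, hKk⟩ f, (ConcreteCategory.bijective_of_isIso i.hom).1 ?_⟩
  rw [← hy, ← hf, Functor.map_comp]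
  exact stableHomFunctorIso_hom_app_stableEval_map ..

include hγ in
lemma eq_zero_of_stableEval_map_eq_zero {K : CochainComplex (ModuleCat.{u} A) ℤ}
    (hK : HasBoundedFGCohomology K) (hKk : K.IsStrictlyLE (k - 1))
    (f : toMinusFG.{w} P hP hb ⟶ toMinusFG.{w} K hK ⟨_, hKk⟩)
    (hf : stableEval γ hT hT' hP hb _ (homotopyToSingularity.map f) = 0) : f = 0 := by
  obtain ⟨g, hg⟩ := (HomotopyCategory.quotient _ _).map_surjective f.hom
  have h := stableHomFunctorIso_hom_app_stableEval_map γ hT hT' hP hb f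
  rw [hf, map_zero, ← hg, ← Functor.map_comp] at h
  have h' : (HomotopyCategory.quotient _ _).map (γ ≫ g) = 0 := h.symm
  rw [HomotopyCategory.quotient_map_eq_zero_iff] at h'
  obtain ⟨H⟩ := nonempty_homotopy_zero_of_isIso_f γ hγ g h'.some
  ext
  rw [← hg]
  exact (HomotopyCategory.eq_of_homotopy _ _ H).trans (Functor.map_zero _ _ _)

/-- Up to a morphism with perfect cone, every object of `D^b(A)` is a complex strictly concentrated in
degrees `≤ k`, for any given `k`. -/
lemma exists_trW_toMinusFG (X : DerivedBounded.{w} A) (k : ℤ) :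
    ∃ (K : CochainComplex (ModuleCat.{u} A) ℤ) (hK : HasBoundedFGCohomology K)
      (hKk : K.IsStrictlyLE k) (s : X ⟶ (toDerivedBounded A).obj (toMinusFG K hK ⟨k, hKk⟩)),
      (perfectBounded A).trW s := by
  obtain ⟨Y, s, hs, hY⟩ := exists_trW_isLE X k
  obtain ⟨K, e, hKk⟩ := hY.le
  have hK : HasBoundedFGCohomology K :=
    (boundedFG_Q_obj_iff K).1 ((boundedFG A).prop_of_iso e Y.property)
  let i : Y ≅ (toDerivedBounded A).obj (toMinusFG K hK ⟨k, hKk⟩) :=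
    (boundedFG A).isoMk (e ≪≫ ((DerivedCategory.quotientCompQhIso _).app K).symm)
  exact ⟨K, hK, hKk, s ≫ i.hom, (MorphismProperty.cancel_right_of_respectsIso _ _ _).2 hs⟩

include hγ in
/-- Up to a morphism with perfect cone, every object of `D^b(A)` is a complex concentrated in the
degrees where `γ` is an isomorphism, and for such a complex the two sides agree already before
passing to the singularity category. -/
lemma stableEval_bijective [P.IsKProjective] (X : Singularity.{w} A) :
    Function.Bijective (stableEval.{w} γ hT hT' hP hb X) := by
  obtain ⟨X, rfl⟩ := (Localization.Construction.objEquiv (perfectBounded.{w} A).trW).surjective X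
  change Function.Bijective (stableEval.{w} γ hT hT' hP hb ((toSingularity A).obj X))
  constructor
  · rw [injective_iff_map_eq_zero]
    intro a ha
    obtain ⟨φ, hφ⟩ := Localization.exists_leftFraction (toSingularity A) (perfectBounded.{w} A).trW
      (X := (toDerivedBounded A).obj (toMinusFG.{w} P hP hb)) a
    obtain ⟨K, hK, hKk, t, ht⟩ := exists_trW_toMinusFG φ.Y' (k - 1)
    obtain ⟨g, hg⟩ := toDerivedBounded_map_surjective hP hb (φ.f ≫ t)
    have := Localization.inverts (toSingularity A) (perfectBounded.{w} A).trW _ φ.hs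
    have := Localization.inverts (toSingularity A) (perfectBounded.{w} A).trW _ ht
    have h₁ : a ≫ (toSingularity A).map φ.s ≫ (toSingularity A).map t =
        homotopyToSingularity.map g := by
      rw [hφ, MorphismProperty.LeftFraction.map_comp_map_s_assoc, ← Functor.map_comp, ← hg]
      rfl
    have h₂ : g = 0 := by
      apply eq_zero_of_stableEval_map_eq_zero γ hT hT' hP hb hγ hK hKk
      rw [← h₁, stableEval_comp, ha, map_zero]
    rw [← cancel_mono ((toSingularity A).map φ.s ≫ (toSingularity A).map t), h₁, h₂, zero_comp]
    exact Functor.map_zero _ _ _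
  · intro x
    obtain ⟨K, hK, hKk, s, hs⟩ := exists_trW_toMinusFG X (k - 1)
    have := Localization.inverts (toSingularity A) (perfectBounded.{w} A).trW _ hs
    obtain ⟨f, hf⟩ := exists_stableEval_map_eq γ hT hT' hP hb hγ hK hKk
      ((stableHomFunctor.{w} T hT hT').map ((toSingularity A).map s) x)
    refine ⟨homotopyToSingularity.map f ≫ inv ((toSingularity A).map s), ?_⟩
    rw [stableEval_comp, hf, ← ConcreteCategory.comp_apply, ← Functor.map_comp,
      IsIso.hom_inv_id, CategoryTheory.Functor.map_id, ConcreteCategory.id_apply]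

end Comparison

/-! ### Cohomology of the Hom complex as homotopy classes -/

section HomCohomology

variable {A : Type u} [CommRing A]

lemma quotient_map_cocycleToHom_eq_zero_iff (K L : CochainComplex (ModuleCat.{u} A) ℤ) (q : ℤ)
    (z : HomComplex.Cocycle K L q) :
    (HomotopyCategory.quotient (ModuleCat.{u} A) (.up ℤ)).map (cocycleToHom K L q z) = 0 ↔
      z ∈ homCoboundaries K L q :=
  (HomComplex.CohomologyClass.toHom_mk_eq_zero_iff z).trans
    (HomComplex.mem_coboundaries_iff _ (q - 1) (by simp))

/-- Cohomology classes of `Hom_A(K, L)` of degree `q` are homotopy classes of morphisms from `K` to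
`L[q]`. -/
def homCohomologyEquiv (K L : CochainComplex (ModuleCat.{u} A) ℤ) (q : ℤ) :
    HomCohomology K L q ≃ₗ[A] ((HomotopyCategory.quotient (ModuleCat.{u} A) (.up ℤ)).obj K ⟶
      (HomotopyCategory.quotient _ _).obj (L⟦q⟧)) :=
  LinearEquiv.ofBijective
    (Submodule.liftQ _ ((HomotopyCategory.quotient (ModuleCat.{u} A) (.up ℤ)).mapLinearMap A ∘ₗ
      cocycleToHom K L q) (fun z hz => (quotient_map_cocycleToHom_eq_zero_iff K L q z).2 hz)) (by
    constructor
    · rw [← LinearMap.ker_eq_bot, Submodule.ker_liftQ_eq_bot']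
      ext z
      exact (quotient_map_cocycleToHom_eq_zero_iff K L q z).symm
    · intro f
      obtain ⟨f, rfl⟩ := (HomotopyCategory.quotient _ _).map_surjective f
      obtain ⟨z, rfl⟩ : ∃ z, cocycleToHom K L q z = f :=
        HomComplex.Cocycle.equivHomShift.symm.surjective f
      exact ⟨Submodule.Quotient.mk z, rfl⟩)

lemma homCohomologyEquiv_mk (K L : CochainComplex (ModuleCat.{u} A) ℤ) (q : ℤ)
    (z : HomComplex.Cocycle K L q) :
    homCohomologyEquiv K L q (Submodule.Quotient.mk z) =
      (HomotopyCategory.quotient _ _).map (cocycleToHom K L q z) :=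
  rfl

lemma homCohomologyEquiv_postcomp (K : CochainComplex (ModuleCat.{u} A) ℤ)
    {L L' : CochainComplex (ModuleCat.{u} A) ℤ} (g : L ⟶ L') (q : ℤ) (x : HomCohomology K L q) :
    homCohomologyEquiv K L' q (homCohomologyPostcomp K g q x) =
      homCohomologyEquiv K L q x ≫ (HomotopyCategory.quotient _ _).map (g⟦q⟧') := by
  obtain ⟨z, rfl⟩ := Submodule.Quotient.mk_surjective _ x
  rw [homCohomologyEquiv_mk, ← Functor.map_comp]
  change (HomotopyCategory.quotient _ _).map (cocycleToHom K L' q (z.postcomp g)) = _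
  congr 1

lemma homCohomologyEquiv_precomp {K' K : CochainComplex (ModuleCat.{u} A) ℤ} (f : K' ⟶ K)
    (L : CochainComplex (ModuleCat.{u} A) ℤ) (q : ℤ) (x : HomCohomology K L q) :
    homCohomologyEquiv K' L q (homCohomologyPrecomp f L q x) =
      (HomotopyCategory.quotient _ _).map f ≫ homCohomologyEquiv K L q x := by
  obtain ⟨z, rfl⟩ := Submodule.Quotient.mk_surjective _ x
  rw [homCohomologyEquiv_mk, ← Functor.map_comp]
  change (HomotopyCategory.quotient _ _).map (cocycleToHom K' L q (z.precomp f)) = _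
  congr 1
  ext p : 1
  simp [cocycleToHom, HomComplex.Cocycle.equivHomShift_symm_apply, HomComplex.Cocycle.homOf,
    HomComplex.Cochain.rightShift_v _ q 0 _ p p _ (p + q) rfl]
  exact Category.assoc _ _ _

end HomCohomology

section Ext

variable {A : Type u} [CommRing A] [HasDerivedCategory.{w} (ModuleCat.{u} A)]

lemma homToDerived_eq (q : ℤ) {P M : CochainComplex (ModuleCat.{u} A) ℤ} (δ : P ⟶ M)
    (hδ : QuasiIso δ) (N : CochainComplex (ModuleCat.{u} A) ℤ) (x : HomCohomology P N q) :
    homToDerived.{w} q δ hδ N x = inv (DerivedCategory.Q.map δ) ≫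
      (DerivedCategory.quotientCompQhIso _).inv.app P ≫
        DerivedCategory.Qh.map (homCohomologyEquiv P N q x) ≫
          (DerivedCategory.quotientCompQhIso _).hom.app (N⟦q⟧) := by
  obtain ⟨z, rfl⟩ := Submodule.Quotient.mk_surjective _ x
  rw [homCohomologyEquiv_mk, DerivedCategory.quotientCompQhIso_hom_naturality]
  simp [homToDerived]

lemma homToDerived_bijective (q : ℤ) {P M : CochainComplex (ModuleCat.{u} A) ℤ} (δ : P ⟶ M)
    (hδ : QuasiIso δ) [P.IsKProjective] (N : CochainComplex (ModuleCat.{u} A) ℤ) :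
    Function.Bijective (homToDerived.{w} q δ hδ N) := by
  let e : DerivedCategory.Q.obj M ≅ DerivedCategory.Qh.obj ((HomotopyCategory.quotient _ _).obj P) :=
    (asIso (DerivedCategory.Q.map δ)).symm ≪≫ (DerivedCategory.quotientCompQhIso _).symm.app P
  have := (e.symm.homCongr ((DerivedCategory.quotientCompQhIso _).app (N⟦q⟧))).bijective.comp
    ((IsKProjective.Qh_map_bijective P ((HomotopyCategory.quotient _ _).obj (N⟦q⟧))).comp
      (homCohomologyEquiv P N q).bijective)
  convert this using 1
  ext x
  rw [homToDerived_eq]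
  simp [e]

end Ext

/-! ### Stable Ext-modules as homotopy classes -/

section StableExt

variable {A : Type u} [CommRing A] [IsNoetherianRing A] [HasDerivedCategory.{w} (ModuleCat.{u} A)]
  {T P : CochainComplex (ModuleCat.{u} A) ℤ} (γ : T ⟶ P)
  (hT : ∀ i, Module.Projective A (T.X i))
  (hT' : ∀ q : ℤ, Subsingleton
    (HomCohomology T ((singleFunctor (ModuleCat.{u} A) 0).obj (ModuleCat.of A A)) q))
  (hP : HasBoundedFGCohomology P) (hb : ∃ b : ℤ, P.IsStrictlyLE b)
  {X : Singularity.{w} A} (e : homotopyToSingularity.obj (toMinusFG P hP hb) ≅ X)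

/-- The map sending a stable morphism from `X ≅ P` to `L` to a homotopy class of morphisms from
`T` to `L`, given by evaluation at the class of `γ : T ⟶ P`. -/
def stableHomToHom {L : CochainComplex (ModuleCat.{u} A) ℤ} (hL : HasBoundedFGCohomology L)
    (hbL : ∃ b : ℤ, L.IsStrictlyLE b) :
    (X ⟶ (toSingularity A).obj (toBounded.{w} L hL)) →+
      ((HomotopyCategory.quotient _ _).obj T ⟶ (HomotopyCategory.quotient _ _).obj L) :=
  ((stableHomFunctorIso.{w} T hT hT').hom.app (toMinusFG L hL hbL)).hom.comp <|
    (stableEval γ hT hT' hP hb _).comp <|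
      (Preadditive.leftComp _ e.hom).comp <|
        Preadditive.rightComp _ ((toSingularity A).map (toDerivedBoundedObjIso L hL hbL).inv)

lemma stableHomToHom_apply {L : CochainComplex (ModuleCat.{u} A) ℤ} (hL : HasBoundedFGCohomology L)
    (hbL : ∃ b : ℤ, L.IsStrictlyLE b) (a : X ⟶ (toSingularity A).obj (toBounded.{w} L hL)) :
    stableHomToHom γ hT hT' hP hb e hL hbL a =
      (stableHomFunctorIso.{w} T hT hT').hom.app (toMinusFG L hL hbL)
        (stableEval γ hT hT' hP hb _
          (e.hom ≫ a ≫ (toSingularity A).map (toDerivedBoundedObjIso L hL hbL).inv)) :=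
  rfl

lemma stableHomToHom_bijective [P.IsKProjective] {k : ℤ} (hγ : ∀ i ≤ k, IsIso (γ.f i))
    {L : CochainComplex (ModuleCat.{u} A) ℤ} (hL : HasBoundedFGCohomology L)
    (hbL : ∃ b : ℤ, L.IsStrictlyLE b) :
    Function.Bijective (stableHomToHom.{w} γ hT hT' hP hb e hL hbL) :=
  (ConcreteCategory.bijective_of_isIso
    ((stableHomFunctorIso.{w} T hT hT').hom.app (toMinusFG L hL hbL))).comp <|
      (stableEval_bijective γ hT hT' hP hb hγ _).comp
        (e.symm.homCongr ((toSingularity A).mapIso (toDerivedBoundedObjIso L hL hbL).symm)).bijective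

lemma stableHomToHom_comp {L L' : CochainComplex (ModuleCat.{u} A) ℤ}
    (hL : HasBoundedFGCohomology L) (hbL : ∃ b : ℤ, L.IsStrictlyLE b)
    (hL' : HasBoundedFGCohomology L') (hbL' : ∃ b : ℤ, L'.IsStrictlyLE b)
    (a : X ⟶ (toSingularity A).obj (toBounded.{w} L hL)) (g : L ⟶ L') :
    stableHomToHom γ hT hT' hP hb e hL' hbL' (a ≫ (toSingularity A).map (toBoundedMap hL hL' g)) =
      stableHomToHom γ hT hT' hP hb e hL hbL a ≫ (HomotopyCategory.quotient _ _).map g := by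
  have h : toBoundedMap hL hL' g ≫ (toDerivedBoundedObjIso L' hL' hbL').inv =
      (toDerivedBoundedObjIso L hL hbL).inv ≫
        (toDerivedBounded A).map (toMinusFGMap.{w} hL hL' hbL hbL' g) := by
    rw [Iso.comp_inv_eq, Category.assoc, toDerivedBoundedObjIso_hom_naturality,
      Iso.inv_hom_id_assoc]
  have h' : e.hom ≫ (a ≫ (toSingularity A).map (toBoundedMap hL hL' g)) ≫
        (toSingularity A).map (toDerivedBoundedObjIso L' hL' hbL').inv =
      (e.hom ≫ a ≫ (toSingularity A).map (toDerivedBoundedObjIso L hL hbL).inv) ≫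
        homotopyToSingularity.map (toMinusFGMap.{w} hL hL' hbL hbL' g) := by
    simp only [Category.assoc, ← Functor.map_comp, h]
    simp
  rw [stableHomToHom_apply, h', stableEval_comp]
  exact ConcreteCategory.congr_hom ((stableHomFunctorIso.{w} T hT hT').hom.naturality
    (toMinusFGMap.{w} hL hL' hbL hbL' g)) _

lemma stableHomToHom_map {L : CochainComplex (ModuleCat.{u} A) ℤ} (hL : HasBoundedFGCohomology L)
    (hbL : ∃ b : ℤ, L.IsStrictlyLE b) (f : toMinusFG.{w} P hP hb ⟶ toMinusFG L hL hbL) :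
    stableHomToHom γ hT hT' hP hb e hL hbL (e.inv ≫ homotopyToSingularity.map f ≫
        (toSingularity A).map (toDerivedBoundedObjIso L hL hbL).hom) =
      (HomotopyCategory.quotient _ _).map γ ≫ f.hom := by
  have h : e.hom ≫ (e.inv ≫ homotopyToSingularity.map f ≫
      (toSingularity A).map (toDerivedBoundedObjIso L hL hbL).hom) ≫
        (toSingularity A).map (toDerivedBoundedObjIso L hL hbL).inv =
      homotopyToSingularity.map f := by
    simp only [Category.assoc, Iso.hom_inv_id_assoc, ← Functor.map_comp, Iso.hom_inv_id]
    rw [CategoryTheory.Functor.map_id]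
    exact Category.comp_id _
  rw [stableHomToHom_apply, h]
  exact stableHomFunctorIso_hom_app_stableEval_map γ hT hT' hP hb f

/-- If `γ` is an isomorphism in low degrees, stable morphisms from `X ≅ P` to `L` are homotopy
classes of morphisms from `T` to `L`. -/
def stableHomEquiv [P.IsKProjective] {k : ℤ} (hγ : ∀ i ≤ k, IsIso (γ.f i))
    {L : CochainComplex (ModuleCat.{u} A) ℤ} (hL : HasBoundedFGCohomology L)
    (hbL : ∃ b : ℤ, L.IsStrictlyLE b) :
    (X ⟶ (toSingularity A).obj (toBounded.{w} L hL)) ≃ₗ[A]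
      ((HomotopyCategory.quotient _ _).obj T ⟶ (HomotopyCategory.quotient _ _).obj L) :=
  LinearEquiv.ofBijective
    { toFun := stableHomToHom γ hT hT' hP hb e hL hbL
      map_add' := map_add _
      -- scalar multiplication is composition with `r • 𝟙 L`, so linearity is naturality in `L`
      map_smul' := fun r a => by
        have h := stableHomToHom_comp γ hT hT' hP hb e hL hbL hL hbL a (r • 𝟙 L)
        have h₁ : toBoundedMap.{w} hL hL (r • 𝟙 L) = r • 𝟙 (toBounded.{w} L hL) := by
          ext
          change DerivedCategory.Q.map (r • 𝟙 L) = r • 𝟙 _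
          rw [Functor.map_smul, CategoryTheory.Functor.map_id]
        rwa [h₁, Functor.map_smul, Functor.map_smul, CategoryTheory.Functor.map_id,
          CategoryTheory.Functor.map_id, Linear.comp_smul, Linear.comp_smul, Category.comp_id,
          Category.comp_id] at h }
    (stableHomToHom_bijective γ hT hT' hP hb e hγ hL hbL)

end StableExt

section Resolution

variable {A : Type u} [CommRing A]

lemma HasBoundedFGCohomology.of_quasiIso {K L : CochainComplex (ModuleCat.{u} A) ℤ} (f : K ⟶ L)
    [QuasiIso f] (hL : HasBoundedFGCohomology L) : HasBoundedFGCohomology K := by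
  obtain ⟨h₁, a, b, h₂⟩ := hL
  refine ⟨fun n => ?_, a, b, fun n hn => (h₂ n hn).of_iso (isoOfQuasiIsoAt f n)⟩
  have := h₁ n
  exact Module.Finite.equiv (isoOfQuasiIsoAt f n).symm.toLinearEquiv

lemma IsCompleteResolution.isKProjective {T P M : CochainComplex (ModuleCat.{u} A) ℤ} {γ : T ⟶ P}
    {δ : P ⟶ M} (h : IsCompleteResolution γ δ) : P.IsKProjective := by
  obtain ⟨b, _⟩ := h.boundedAbove_P
  have (n : ℤ) : Projective (P.X n) := (IsProjective.iff_projective (P.X n)).1 (h.projective_P n)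
  exact isKProjective_of_projective P b

end Resolution

end

end StableExtension

open CategoryTheory StableExtension in
theorem lemmaB3 {A : Type u} [CommRing A] [IsNoetherianRing A]
    [HasDerivedCategory.{w} (ModuleCat.{u} A)]
    {T P M : CochainComplex (ModuleCat.{u} A) ℤ} (hM : HasBoundedFGCohomology M)
    (γ : T ⟶ P) (δ : P ⟶ M) (hres : IsCompleteResolution γ δ) (q : ℤ) :
    ∃ η : ∀ (N : CochainComplex (ModuleCat.{u} A) ℤ) (hN : HasBoundedFGCohomology N),
        (∃ b : ℤ, N.IsStrictlyLE b) → (HomCohomology T N q ≃ₗ[A] StableExt.{w} q hM hN),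
      -- naturality in `N`
      (∀ (N N' : CochainComplex (ModuleCat.{u} A) ℤ)
        (hN : HasBoundedFGCohomology N) (hN' : HasBoundedFGCohomology N')
        (hb : ∃ b : ℤ, N.IsStrictlyLE b) (hb' : ∃ b : ℤ, N'.IsStrictlyLE b)
        (g : N ⟶ N') (x : HomCohomology T N q),
        η N' hN' hb' (homCohomologyPostcomp T g q x) =
          stableExtPostcomp q hM hN hN' g (η N hN hb x)) ∧
      -- the commutative square, in which the left vertical map is an isomorphism
      (∀ (N : CochainComplex (ModuleCat.{u} A) ℤ) (hN : HasBoundedFGCohomology N)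
        (hb : ∃ b : ℤ, N.IsStrictlyLE b),
        Function.Bijective (homToExt.{w} q δ hres.quasiIso hM hN) ∧
        ∀ x : HomCohomology P N q,
          η N hN hb (homCohomologyPrecomp γ N q x) =
            extToStableExt q hM hN (homToExt q δ hres.quasiIso hM hN x)) := by
  have := hres.quasiIso
  have := hres.isKProjective
  have hP : HasBoundedFGCohomology P := hM.of_quasiIso δ
  obtain ⟨k, hγ⟩ := hres.isIso_le
  have hshift {N : CochainComplex (ModuleCat.{u} A) ℤ} :
      (∃ b : ℤ, N.IsStrictlyLE b) → ∃ b : ℤ, (N⟦q⟧).IsStrictlyLE b := by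
    rintro ⟨b, _⟩
    exact ⟨b - q, N.isStrictlyLE_shift b q _ (by lia)⟩
  let eδ : toBounded.{w} P hP ≅ toBounded M hM :=
    (boundedFG A).isoMk (asIso (DerivedCategory.Q.map δ))
  let e : homotopyToSingularity.obj (toMinusFG.{w} P hP hres.boundedAbove_P) ≅
      (toSingularity A).obj (toBounded M hM) :=
    (toSingularity A).mapIso (toDerivedBoundedObjIso P hP hres.boundedAbove_P ≪≫ eδ)
  let Θ (N : CochainComplex (ModuleCat.{u} A) ℤ) (hN : HasBoundedFGCohomology N)
      (hb : ∃ b : ℤ, N.IsStrictlyLE b) :=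
    stableHomEquiv.{w} γ hres.projective_T hres.acyclic_dual hP hres.boundedAbove_P e hγ
      (hN.shift q) (hshift hb)
  refine ⟨fun N hN hb => homCohomologyEquiv T N q ≪≫ₗ (Θ N hN hb).symm, ?_, ?_⟩
  · intro N N' hN hN' hb hb' g x
    rw [LinearEquiv.trans_apply, LinearEquiv.trans_apply, LinearEquiv.symm_apply_eq,
      homCohomologyEquiv_postcomp]
    obtain ⟨a, ha⟩ := (Θ N hN hb).surjective (homCohomologyEquiv T N q x)
    rw [← ha, LinearEquiv.symm_apply_apply]
    exact (stableHomToHom_comp ..).symm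
  · intro N hN hb
    constructor
    · exact (ObjectProperty.fullyFaithfulι (boundedFG A)).homEquiv.symm.bijective.comp
        (homToDerived_bijective q δ hres.quasiIso N)
    · intro x
      rw [LinearEquiv.trans_apply, LinearEquiv.symm_apply_eq, homCohomologyEquiv_precomp]
      let f : toMinusFG.{w} P hP hres.boundedAbove_P ⟶ toMinusFG _ (hN.shift q) (hshift hb) :=
        ObjectProperty.homMk (homCohomologyEquiv P N q x)
      refine (stableHomToHom_map γ hres.projective_T hres.acyclic_dual hP hres.boundedAbove_P e
        (hN.shift q) (hshift hb) f).symm.trans (congrArg _ ?_)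
      change (toSingularity A).map _ ≫ (toSingularity A).map _ ≫ (toSingularity A).map _ =
        (toSingularity A).map _
      rw [← Functor.map_comp, ← Functor.map_comp]
      congr 1
      ext
      refine Eq.trans ?_ (homToDerived_eq q δ hres.quasiIso N x).symm
      exact Category.assoc _ _ _
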